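/- Let $f:\mathbb R^n\to\mathbb R\cup\{\pm\infty\}$ be a proper convex function, let $x\in\mathbb R^n$, $x\neq 0$, and suppose that the subdifferential $\partial f(x)=\{z: f(y)\ge f(x)+\langle z,y-x\rangle\ \forall y\in\mathbb R^n\}$ is non-empty. Let $g\in\mathbb R^n$ be a standard Gaussian vector (i.i.d. $N(0,1)$ entries). Suppose that there is a vector $z_0\neq 0$, not necessarily in $\partial f(x)$, such that $$\langle z-z_0,z_0\rangle=0\qquad\text{for all } z\in\partial f(x).$$ Let $\mathcal D(f,x)=\bigcup_{t>0}\{z\in\mathbb R^n: f(x+tz)\le f(x)\}$ be the descent cone, let $\mathbb B^n$ be the closed Euclidean unit ball, let $\omega(C)=\mathbb E\sup_{y\in C}\langle y,g\rangle$ be the Gaussian width, let $\delta(C)=\mathbb E\,\mathrm{dist}^2(g,C^\circ)$ be the statistical dimension of a convex cone $C$, where $C^\circ=\{v:\langle v,z\rangle\le 0\ \forall z\in C\}$, and put $$E_\delta=\inf_{t\ge 0}\mathbb E\,\mathrm{dist}^2(g,t\,\partial f(x))-\delta(\mathcal D(f,x)).$$ Then $\partial f(x)$ has a unique element $z_1$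 of minimum Euclidean norm and, with $\beta=\|z_1\|_2/\|z_0\|_2$, the following hold. 1. For all $\lambda,\zeta>0$ with $1-4e^{-\lambda^2/2}-2e^{-\zeta^2/2}>0$, $$0\le E_\delta\le (4\lambda\beta+\gamma)\,\omega(\mathcal D(f,x)\cap\mathbb B^n)+\gamma(\zeta+2\lambda\beta)+4\lambda^2\beta^2,\qquad \gamma=\sqrt{72}\,\sqrt{\ln\frac{3}{1-4e^{-\lambda^2/2}-2e^{-\zeta^2/2}}}.$$ 2. $$0\le\inf_{t\ge 0}\mathbb E\,\mathrm{dist}(g,t\,\partial f(x))-\omega(\mathcal D(f,x)\cap\mathbb B^n)\le 1.6+4\beta.$$ -/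

import Mathlib

open MeasureTheory ProbabilityTheory
open scoped Pointwise

noncomputable section

/-- `f : E → ℝ ∪ {±∞}` is proper convex: it never takes the value `-∞`, it is finite somewhere,
and its epigraph is a convex subset of `E × ℝ`. -/
structure IsProperConvex {E : Type*} [AddCommGroup E] [Module ℝ E] (f : E → EReal) : Prop where
  ne_bot : ∀ y, f y ≠ ⊥
  exists_ne_top : ∃ y, f y ≠ ⊤
  convex_epigraph : Convex ℝ {p : E × ℝ | f p.1 ≤ (p.2 : EReal)}

/-- The subdifferential `∂f(x)`. -/
def subdifferential {E : Type*} [NormedAddCommGroup E] [InnerProductSpace ℝ E]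
    (f : E → EReal) (x : E) : Set E :=
  {z | ∀ y, f x + ((inner ℝ z (y - x) : ℝ) : EReal) ≤ f y}

/-- The descent cone `D(f, x) = ⋃_{t > 0} {z | f (x + t z) ≤ f x}`. -/
def descentCone {E : Type*} [AddCommGroup E] [Module ℝ E] (f : E → EReal) (x : E) : Set E :=
  {z | ∃ t : ℝ, 0 < t ∧ f (x + t • z) ≤ f x}

/-- The polar cone `C° = {v | ⟪v, z⟫ ≤ 0 for all z ∈ C}`. -/
def polarCone {E : Type*} [NormedAddCommGroup E] [InnerProductSpace ℝ E] (C : Set E) : Set E :=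
  {v | ∀ z ∈ C, inner ℝ v z ≤ 0}

/-- The statistical dimension `δ(C) = 𝔼 dist²(g, C°)` of a convex cone, `g` standard Gaussian.
(This form makes sense whether or not `C` is closed, and gives `C` and its closure the same
statistical dimension.) -/
def statDim {n : ℕ} (C : Set (EuclideanSpace ℝ (Fin n))) : ℝ :=
  ∫ g, Metric.infDist g (polarCone C) ^ 2 ∂(stdGaussian (EuclideanSpace ℝ (Fin n)))

/-- The Gaussian width `ω(C) = 𝔼 sup_{y ∈ C} ⟪y, g⟫`, `g` standard Gaussian. -/
def gaussianWidth {n : ℕ} (C : Set (EuclideanSpace ℝ (Fin n))) : ℝ :=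
  ∫ g, sSup ((fun y => inner ℝ y g) '' C) ∂(stdGaussian (EuclideanSpace ℝ (Fin n)))

/-- `inf_{t ≥ 0} 𝔼 dist(g, t S)`, `g` standard Gaussian. -/
def infExpDist {n : ℕ} (S : Set (EuclideanSpace ℝ (Fin n))) : ℝ :=
  sInf ((fun t : ℝ => ∫ g, Metric.infDist g (t • S)
    ∂(stdGaussian (EuclideanSpace ℝ (Fin n)))) '' Set.Ici 0)

/-- `inf_{t ≥ 0} 𝔼 dist²(g, t S)`, `g` standard Gaussian. -/
def infExpSqDist {n : ℕ} (S : Set (EuclideanSpace ℝ (Fin n))) : ℝ :=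
  sInf ((fun t : ℝ => ∫ g, Metric.infDist g (t • S) ^ 2
    ∂(stdGaussian (EuclideanSpace ℝ (Fin n)))) '' Set.Ici 0)

/-- The error `E_δ = inf_{t ≥ 0} 𝔼 dist²(g, t ∂f(x)) - δ(D(f, x))`. -/
def errorGap {n : ℕ} (f : EuclideanSpace ℝ (Fin n) → EReal) (x : EuclideanSpace ℝ (Fin n)) : ℝ :=
  infExpSqDist (subdifferential f x) - statDim (descentCone f x)

/-- `z₁` is a point of `S` of minimum norm. -/
def IsMinNorm {E : Type*} [NormedAddCommGroup E] (S : Set E) (z₁ : E) : Prop :=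
  z₁ ∈ S ∧ ∀ z ∈ S, ‖z₁‖ ≤ ‖z‖

/-- The constant `γ`, meaningful when `1 - 4 exp(-lam²/2) - 2 exp(-ζ²/2) > 0`. -/
def gammaConst (lam ζ : ℝ) : ℝ :=
  Real.sqrt 72 *
    Real.sqrt (Real.log (3 / (1 - 4 * Real.exp (-lam ^ 2 / 2) - 2 * Real.exp (-ζ ^ 2 / 2))))

end

/-!
Let `S` be the subdifferential, `D` the descent cone and `K = D°` its polar. Since `S` lies in a
hyperplane that misses the origin, no subgradient vanishes and `K` is the closure of the cone
`⋃_{t ≥ 0} t S` (`polarCone_descentCone_subset`; it follows by separation in the cone generated by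
the translated epigraph). Moreover `sup {⟪y, g⟫ : y ∈ D, ‖y‖ ≤ 1} = dist(g, K)`
(`sSup_inner_cone_inter_closedBall`). So the Gaussian width and the statistical dimension are the
first and second moments of `ψ(g) = dist(g, K)`, and the lower bounds hold because `t S ⊆ K`.

For the upper bounds, let `p` be the projection of `g` onto `K`. If the height
`τ = ⟪p, z₀⟫ / ‖z₀‖²` of `p` in the cone is less than `T`, then `p + (T - τ) z₁` lies in the closure
of `T S` (`infDist_smul_le`), so `φ(g) = dist(g, T S)` is at most `ψ(g) + (T - τ) ‖z₁‖`. Now `φ`, `ψ`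
and `τ ‖z₀‖` are `1`-Lipschitz functions of `g`, hence of variance at most `π² / 8 ≤ 5 / 4`
(`LipschitzWith.variance_stdGaussian_le`). With `T = 𝔼 τ + lam / ‖z₀‖` one gets `φ ≤ ψ + 2 lam β` on
an event of probability bounded below by Chebyshev's inequality. If `𝔼 φ - 𝔼 ψ - 2 lam β` were
large, then on that event `φ - ψ` would be far below its mean, which Cantelli's inequality
forbids (`integral_le_integral_add_of_variance_le`). The resulting bound
`𝔼 φ ≤ 𝔼 ψ + 2 lam β + c` gives the width estimate for `lam = 2`, `c = 1.6`; squaring it and adding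
the variance of `φ` gives the estimate for the statistical dimension. The logarithmic constant
`gammaConst` exceeds what this argument needs, so that variance bounds suffice in place of Gaussian
concentration.

The variance bound itself compares `F` at the two ends of a quarter turn joining independent
copies `x` and `y` of the Gaussian vector. A pair of independent Gaussian vectors is invariant under
rotation, so the turn may be cut into `N` steps of equal law; as `N → ∞` each step is governed by the
derivative of `F`, which exists almost everywhere by Rademacher's theorem.
-/

/-! ### A variance bound for Lipschitz functions of a Gaussian vector -/

theorem absolutelyContinuous_pi_fin {n : ℕ} {α : Fin n → Type*} [∀ i, MeasurableSpace (α i)]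
    {μ ν : ∀ i, Measure (α i)} [∀ i, SigmaFinite (μ i)] [∀ i, SigmaFinite (ν i)]
    (h : ∀ i, μ i ≪ ν i) : Measure.pi μ ≪ Measure.pi ν := by
  induction n with
  | zero =>
    rw [Measure.pi_of_empty μ, Measure.pi_of_empty ν]
  | succ n ih =>
    have hμ := (measurePreserving_piFinSuccAbove μ 0).symm.map_eq
    have hν := (measurePreserving_piFinSuccAbove ν 0).symm.map_eq
    rw [← hμ, ← hν]
    exact ((h 0).prod (ih fun j => h _)).map (MeasurableEquiv.measurable _)

theorem stdGaussian_absolutelyContinuous (n : ℕ) :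
    stdGaussian (EuclideanSpace ℝ (Fin n)) ≪ volume := by
  rw [← map_pi_eq_stdGaussian, ← (PiLp.volume_preserving_toLp (Fin n)).map_eq]
  exact (absolutelyContinuous_pi_fin fun i =>
    gaussianReal_absolutelyContinuous 0 one_ne_zero).map (by fun_prop)

section Variance

variable {n : ℕ} {F : EuclideanSpace ℝ (Fin n) → ℝ} {L : NNReal}

theorem LipschitzWith.memLp_stdGaussian (hF : LipschitzWith L F) :
    MemLp F 2 (stdGaussian (EuclideanSpace ℝ (Fin n))) := by
  have hn : MemLp (fun x => (L : ℝ) * ‖x‖) 2 (stdGaussian (EuclideanSpace ℝ (Fin n))) :=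
    (IsGaussian.memLp_two_id (μ := stdGaussian (EuclideanSpace ℝ (Fin n)))).norm.const_mul _
  have h : MemLp (fun x => |F 0| + L * ‖x‖) 2 (stdGaussian (EuclideanSpace ℝ (Fin n))) :=
    (memLp_const |F 0|).add hn
  refine h.of_le hF.continuous.aestronglyMeasurable (.of_forall fun x => ?_)
  have h1 := hF.dist_le_mul x 0
  rw [Real.dist_eq, dist_zero_right] at h1
  have h2 : |F x| ≤ |F x - F 0| + |F 0| := by
    simpa using abs_add_le (F x - F 0) (F 0)
  rw [Real.norm_eq_abs, Real.norm_of_nonneg (by positivity)]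
  linarith

/-- The first component of the rotation by `θ` of a pair of vectors. -/
noncomputable def rotFst (θ : ℝ) (p : EuclideanSpace ℝ (Fin n) × EuclideanSpace ℝ (Fin n)) :
    EuclideanSpace ℝ (Fin n) :=
  Real.cos θ • p.1 + Real.sin θ • p.2

theorem continuous_rotFst (θ : ℝ) : Continuous (rotFst (n := n) θ) := by
  unfold rotFst; fun_prop

theorem rotFst_rotation (θ η : ℝ) (p : EuclideanSpace ℝ (Fin n) × EuclideanSpace ℝ (Fin n)) :
    rotFst θ (ContinuousLinearMap.rotation η p) = rotFst (η + θ) p := by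
  rw [ContinuousLinearMap.rotation_apply, rotFst, rotFst, Real.cos_add, Real.sin_add]
  module

theorem measurePreserving_rotation (θ : ℝ) :
    MeasurePreserving (ContinuousLinearMap.rotation (E := EuclideanSpace ℝ (Fin n)) θ)
      ((stdGaussian _).prod (stdGaussian _)) ((stdGaussian _).prod (stdGaussian _)) :=
  ⟨by fun_prop, IsGaussian.map_rotation_eq_self (by simp) θ⟩

theorem LipschitzWith.memLp_comp_rotFst (hF : LipschitzWith L F) (θ : ℝ) :
    MemLp (fun p => F (rotFst θ p)) 2
      ((stdGaussian (EuclideanSpace ℝ (Fin n))).prod (stdGaussian _)) := by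
  have h := (hF.memLp_stdGaussian.comp_measurePreserving
    (measurePreserving_fst (μ := stdGaussian (EuclideanSpace ℝ (Fin n)))
      (ν := stdGaussian (EuclideanSpace ℝ (Fin n))))).comp_measurePreserving
      (measurePreserving_rotation θ)
  exact h

/-- Cutting the quarter turn from `x` to `y` into `N` rotations, each of which preserves the
law of a pair of independent Gaussian vectors. -/
theorem integral_sq_sub_le_rotFst (hF : LipschitzWith L F) (N : ℕ) (h : ℝ)
    (hN : N * h = Real.pi / 2) :
    ∫ p, (F p.2 - F p.1) ^ 2 ∂((stdGaussian (EuclideanSpace ℝ (Fin n))).prod (stdGaussian _)) ≤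
      N ^ 2 * ∫ p, (F (rotFst h p) - F p.1) ^ 2
        ∂((stdGaussian (EuclideanSpace ℝ (Fin n))).prod (stdGaussian _)) := by
  set P := (stdGaussian (EuclideanSpace ℝ (Fin n))).prod
    (stdGaussian (EuclideanSpace ℝ (Fin n)))
  have hint : ∀ k : ℕ, Integrable
      (fun p => (F (rotFst ((k + 1 : ℕ) * h) p) - F (rotFst (k * h) p)) ^ 2) P := fun k =>
    ((hF.memLp_comp_rotFst _).sub (hF.memLp_comp_rotFst _)).integrable_sq
  have hstep : ∀ k : ℕ, ∫ p, (F (rotFst ((k + 1 : ℕ) * h) p) - F (rotFst (k * h) p)) ^ 2 ∂P =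
      ∫ p, (F (rotFst h p) - F p.1) ^ 2 ∂P := by
    intro k
    have hc : Continuous fun p : EuclideanSpace ℝ (Fin n) × EuclideanSpace ℝ (Fin n) =>
        (F (rotFst h p) - F p.1) ^ 2 :=
      (((hF.continuous.comp (continuous_rotFst h)).sub (hF.continuous.comp continuous_fst)).pow 2)
    have := integral_map (μ := P) (measurePreserving_rotation (n := n) (k * h)).measurable.aemeasurable
      (f := fun p => (F (rotFst h p) - F p.1) ^ 2) hc.aestronglyMeasurable
    rw [(measurePreserving_rotation (n := n) (k * h)).map_eq] at this
    rw [this]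
    refine integral_congr_ae (.of_forall fun p => ?_)
    simp only [rotFst_rotation]
    rw [show (k * h + h) = ((k + 1 : ℕ) * h) by push_cast; ring]
    rfl
  calc ∫ p, (F p.2 - F p.1) ^ 2 ∂P
      = ∫ p, (∑ k ∈ Finset.range N,
          (F (rotFst ((k + 1 : ℕ) * h) p) - F (rotFst (k * h) p))) ^ 2 ∂P := by
        refine integral_congr_ae (.of_forall fun p => ?_)
        simp only
        rw [Finset.sum_range_sub (fun k : ℕ => F (rotFst (k * h) p)), hN]
        simp [rotFst]
    _ ≤ ∫ p, N * ∑ k ∈ Finset.range N,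
          (F (rotFst ((k + 1 : ℕ) * h) p) - F (rotFst (k * h) p)) ^ 2 ∂P := by
        refine integral_mono ?_ ?_ fun p => ?_
        · exact (memLp_finsetSum _ fun k _ =>
            (hF.memLp_comp_rotFst _).sub (hF.memLp_comp_rotFst _)).integrable_sq
        · exact (integrable_finsetSum _ fun k _ => hint k).const_mul _
        · simpa using sq_sum_le_card_mul_sum_sq (s := Finset.range N)
            (f := fun k : ℕ => F (rotFst ((k + 1 : ℕ) * h) p) - F (rotFst (k * h) p))
    _ = N ^ 2 * ∫ p, (F (rotFst h p) - F p.1) ^ 2 ∂P := by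
        rw [integral_const_mul, integral_finsetSum _ fun k _ => hint k,
          Finset.sum_congr rfl fun k _ => hstep k]
        simp; ring

theorem abs_rotFst_sub_le (hF : LipschitzWith L F) (h : ℝ)
    (p : EuclideanSpace ℝ (Fin n) × EuclideanSpace ℝ (Fin n)) :
    |F (rotFst h p) - F p.1| ≤ L * (‖p.1‖ + ‖p.2‖) * |h| := by
  have h1 := hF.dist_le_mul (rotFst h p) p.1
  rw [Real.dist_eq, dist_eq_norm] at h1
  have h2 : rotFst h p - p.1 = (Real.cos h - 1) • p.1 + Real.sin h • p.2 := by
    rw [rotFst]; module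
  have h3 : |Real.cos h - 1| ≤ |h| := by
    simpa using Real.abs_cos_sub_cos_le h 0
  have h4 : |Real.sin h| ≤ |h| := Real.abs_sin_le_abs
  have h5 : ‖rotFst h p - p.1‖ ≤ (‖p.1‖ + ‖p.2‖) * |h| := by
    rw [h2]
    refine (norm_add_le _ _).trans ?_
    rw [norm_smul, norm_smul, Real.norm_eq_abs, Real.norm_eq_abs]
    nlinarith [norm_nonneg p.1, norm_nonneg p.2]
  calc _ ≤ _ := h1
    _ ≤ L * ((‖p.1‖ + ‖p.2‖) * |h|) := by gcongr
    _ = _ := by ring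

theorem integral_sq_strongDual_stdGaussian (ℓ : StrongDual ℝ (EuclideanSpace ℝ (Fin n))) :
    ∫ y, ℓ y ^ 2 ∂(stdGaussian _) = ‖ℓ‖ ^ 2 := by
  rw [← variance_dual_stdGaussian, variance_eq_integral (by fun_prop)]
  simp

theorem integral_sq_fderiv_le (hF : LipschitzWith L F) :
    ∫ p, (fderiv ℝ F p.1 p.2) ^ 2
      ∂((stdGaussian (EuclideanSpace ℝ (Fin n))).prod (stdGaussian _)) ≤ (L : ℝ) ^ 2 := by
  have hnorm : ∀ x, ‖fderiv ℝ F x‖ ≤ L := fun x => norm_fderiv_le_of_lipschitz ℝ hF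
  have hmeas : Measurable fun p : EuclideanSpace ℝ (Fin n) × EuclideanSpace ℝ (Fin n) =>
      (fderiv ℝ F p.1 p.2) ^ 2 := by
    have : Measurable fun p : EuclideanSpace ℝ (Fin n) × EuclideanSpace ℝ (Fin n) =>
        (fderiv ℝ F p.1, p.2) :=
      ((measurable_fderiv ℝ F).comp measurable_fst).prodMk measurable_snd
    exact ((isBoundedBilinearMap_apply (𝕜 := ℝ) (E := EuclideanSpace ℝ (Fin n))
      (F := ℝ)).continuous.measurable.comp this).pow_const 2
  have hint : Integrable (fun p : EuclideanSpace ℝ (Fin n) × EuclideanSpace ℝ (Fin n) =>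
      (fderiv ℝ F p.1 p.2) ^ 2) ((stdGaussian _).prod (stdGaussian _)) := by
    have h2 : Integrable (fun p : EuclideanSpace ℝ (Fin n) × EuclideanSpace ℝ (Fin n) =>
        (L * ‖p.2‖) ^ 2) ((stdGaussian _).prod (stdGaussian _)) :=
      (((IsGaussian.memLp_two_id (μ := stdGaussian (EuclideanSpace ℝ (Fin n)))).norm.const_mul
        (L : ℝ)).comp_measurePreserving measurePreserving_snd).integrable_sq
    refine h2.mono' hmeas.aestronglyMeasurable (.of_forall fun p => ?_)
    rw [Real.norm_of_nonneg (sq_nonneg _), ← sq_abs]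
    gcongr
    exact ((fderiv ℝ F p.1).le_opNorm p.2).trans (by gcongr; exact hnorm _)
  rw [integral_prod _ hint]
  simp only [integral_sq_strongDual_stdGaussian]
  calc ∫ x, ‖fderiv ℝ F x‖ ^ 2 ∂(stdGaussian _)
      ≤ ∫ x, (L : ℝ) ^ 2 ∂(stdGaussian (EuclideanSpace ℝ (Fin n))) := by
        refine integral_mono_of_nonneg (.of_forall fun x => by positivity)
          (integrable_const _) (.of_forall fun x => ?_)
        have := hnorm x
        simp only
        gcongr
    _ = (L : ℝ) ^ 2 := by simp

theorem tendsto_sq_slope_rotFst {p : EuclideanSpace ℝ (Fin n) × EuclideanSpace ℝ (Fin n)}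
    (hd : DifferentiableAt ℝ F p.1) {h : ℕ → ℝ} (h0 : Filter.Tendsto h Filter.atTop (nhds 0))
    (hpos : ∀ᶠ k in Filter.atTop, h k ≠ 0) :
    Filter.Tendsto (fun k => ((F (rotFst (h k) p) - F p.1) / h k) ^ 2) Filter.atTop
      (nhds ((fderiv ℝ F p.1 p.2) ^ 2)) := by
  have hr : HasDerivAt (fun θ => rotFst θ p) p.2 0 := by
    have h1 := ((Real.hasDerivAt_cos 0).smul_const p.1).add
      ((Real.hasDerivAt_sin 0).smul_const p.2)
    simpa [rotFst] using! h1
  have hz : rotFst 0 p = p.1 := by simp [rotFst]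
  have hc : HasDerivAt (fun θ => F (rotFst θ p)) (fderiv ℝ F p.1 p.2) 0 := by
    have := hd.hasFDerivAt
    rw [← hz] at this ⊢
    exact this.comp_hasDerivAt 0 hr
  have hs := hasDerivAt_iff_tendsto_slope.1 hc
  have ht : Filter.Tendsto h Filter.atTop (nhdsWithin 0 {0}ᶜ) :=
    tendsto_nhdsWithin_iff.2 ⟨h0, hpos⟩
  refine ((hs.comp ht).pow 2).congr fun k => ?_
  simp only [Function.comp, slope_def_field, hz, sub_zero]

/-- A Poincaré inequality for the standard Gaussian measure. The constant `π² / 8` comes from the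
length `π / 2` of the quarter turn joining two independent copies; it is not the sharp
constant `1`. -/
theorem LipschitzWith.variance_stdGaussian_le (hF : LipschitzWith L F) :
    Var[F; stdGaussian (EuclideanSpace ℝ (Fin n))] ≤ Real.pi ^ 2 / 8 * L ^ 2 := by
  set γ := stdGaussian (EuclideanSpace ℝ (Fin n)) with hγ
  have hm := hF.memLp_stdGaussian
  have hi : Integrable F γ := hm.integrable one_le_two
  have hvar : ∫ p, (F p.2 - F p.1) ^ 2 ∂(γ.prod γ) = 2 * Var[F; γ] := by
    have e1 : ∀ p : EuclideanSpace ℝ (Fin n) × EuclideanSpace ℝ (Fin n),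
        (F p.2 - F p.1) ^ 2 = F p.2 ^ 2 + F p.1 ^ 2 - 2 * (F p.1 * F p.2) := fun p => by ring
    have i1 : Integrable (fun p : EuclideanSpace ℝ (Fin n) × EuclideanSpace ℝ (Fin n) =>
        F p.2 ^ 2) (γ.prod γ) := hm.integrable_sq.comp_snd γ
    have i2 : Integrable (fun p : EuclideanSpace ℝ (Fin n) × EuclideanSpace ℝ (Fin n) =>
        F p.1 ^ 2) (γ.prod γ) := hm.integrable_sq.comp_fst γ
    have i3 : Integrable (fun p : EuclideanSpace ℝ (Fin n) × EuclideanSpace ℝ (Fin n) =>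
        2 * (F p.1 * F p.2)) (γ.prod γ) := (hi.mul_prod hi).const_mul 2
    simp only [e1]
    rw [integral_sub (by exact i1.add i2) i3, integral_add i1 i2, integral_const_mul,
      integral_prod_mul F F, variance_eq_sub hm]
    have j1 := integral_fun_snd (μ := γ) (ν := γ) (f := fun x => F x ^ 2)
    have j2 := integral_fun_fst (μ := γ) (ν := γ) (f := fun x => F x ^ 2)
    simp only [probReal_univ, one_smul] at j1 j2
    rw [j1, j2]
    simp only [Pi.pow_apply]
    ring
  let h : ℕ → ℝ := fun k => Real.pi / 2 / ((k : ℝ) + 1)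
  have hh : ∀ k, 0 < h k := fun k => by positivity
  have h0 : Filter.Tendsto h Filter.atTop (nhds 0) := by
    have := (tendsto_one_div_add_atTop_nhds_zero_nat (𝕜 := ℝ)).const_mul (Real.pi / 2)
    simpa [h, div_eq_mul_inv] using this
  have hdiff : ∀ᵐ p ∂(γ.prod γ), DifferentiableAt ℝ F p.1 :=
    Measure.quasiMeasurePreserving_fst.ae
      ((stdGaussian_absolutelyContinuous n).ae_le hF.ae_differentiableAt)
  have hlim : Filter.Tendsto
      (fun k => ∫ p, ((F (rotFst (h k) p) - F p.1) / h k) ^ 2 ∂(γ.prod γ)) Filter.atTop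
      (nhds (∫ p, (fderiv ℝ F p.1 p.2) ^ 2 ∂(γ.prod γ))) := by
    refine tendsto_integral_of_dominated_convergence
      (fun p => (L * (‖p.1‖ + ‖p.2‖)) ^ 2) (fun k => ?_) ?_ (fun k => .of_forall fun p => ?_) ?_
    · refine Continuous.aestronglyMeasurable ?_
      exact ((((hF.continuous.comp (continuous_rotFst (h k))).sub
        (hF.continuous.comp continuous_fst)).div_const _).pow 2)
    · have hn := (IsGaussian.memLp_two_id (μ := γ)).norm
      exact (((hn.comp_measurePreserving measurePreserving_fst).add
        (hn.comp_measurePreserving measurePreserving_snd)).const_mul (L : ℝ)).integrable_sq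
    · rw [Real.norm_of_nonneg (sq_nonneg _), ← sq_abs, abs_div]
      gcongr
      rw [div_le_iff₀ (abs_pos.2 (hh k).ne')]
      exact abs_rotFst_sub_le hF _ p
    · filter_upwards [hdiff] with p hp
      exact tendsto_sq_slope_rotFst hp h0 (.of_forall fun k => (hh k).ne')
  have hbound : ∀ k, 2 * Var[F; γ] ≤
      (Real.pi / 2) ^ 2 * ∫ p, ((F (rotFst (h k) p) - F p.1) / h k) ^ 2 ∂(γ.prod γ) := by
    intro k
    have hk : ((k : ℝ) + 1) ≠ 0 := by positivity
    rw [← hvar]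
    refine (integral_sq_sub_le_rotFst hF (k + 1) (h k) ?_).trans (le_of_eq ?_)
    · simp only [h]; push_cast; field_simp
    · simp only [div_pow]
      rw [integral_div, ← hγ]
      generalize ∫ p, (F (rotFst (h k) p) - F p.1) ^ 2 ∂(γ.prod γ) = I
      simp only [h]; push_cast; field_simp
  have := ge_of_tendsto (hlim.const_mul ((Real.pi / 2) ^ 2)) (.of_forall hbound)
  have h3 := integral_sq_fderiv_le hF
  have h4 : (Real.pi / 2) ^ 2 * ∫ p, (fderiv ℝ F p.1 p.2) ^ 2 ∂(γ.prod γ) ≤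
    (Real.pi / 2) ^ 2 * (L : ℝ) ^ 2 := by gcongr
  nlinarith

end Variance

/-! ### Projections onto closed convex sets and separation of cones -/

section Convex

variable {E : Type*} [NormedAddCommGroup E] [InnerProductSpace ℝ E]

/-- The metric projection onto a nonempty closed convex set `K`, with its variational
characterization; it does not increase distances. -/
theorem exists_lipschitz_projection [CompleteSpace E] {K : Set E} (hne : K.Nonempty)
    (hc : IsClosed K) (hK : Convex ℝ K) :
    ∃ q : E → E, LipschitzWith 1 q ∧ ∀ u, q u ∈ K ∧ Metric.infDist u K = ‖u - q u‖ ∧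
      ∀ w ∈ K, inner ℝ (u - q u) (w - q u) ≤ 0 := by
  choose q hqK hq using exists_norm_eq_iInf_of_complete_convex hne hc.isComplete hK
  have hin : ∀ u, ∀ w ∈ K, inner ℝ (u - q u) (w - q u) ≤ 0 := fun u =>
    (norm_eq_iInf_iff_real_inner_le_zero hK (hqK u)).1 (hq u)
  refine ⟨q, LipschitzWith.of_dist_le_mul fun u v => ?_, fun u => ⟨hqK u, ?_, hin u⟩⟩
  · rw [NNReal.coe_one, one_mul, dist_eq_norm, dist_eq_norm]
    have h1 := hin u _ (hqK v)
    have h2 := hin v _ (hqK u)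
    have h3 : ‖q u - q v‖ ^ 2 ≤ inner ℝ (u - v) (q u - q v) := by
      rw [← real_inner_self_eq_norm_sq]
      simp only [inner_sub_left, inner_sub_right] at h1 h2 ⊢
      linarith
    have h4 := real_inner_le_norm (u - v) (q u - q v)
    by_contra! hlt
    have h5 : 0 < ‖q u - q v‖ := (norm_nonneg _).trans_lt hlt
    nlinarith
  · rw [Metric.infDist_eq_iInf, hq u]
    simp only [dist_eq_norm]

/-- A point outside the closure of a convex cone is separated from it by a functional that is
nonpositive on the cone. -/
theorem exists_strongDual_of_notMem_closure_cone {V : Type*} [NormedAddCommGroup V]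
    [NormedSpace ℝ V] {C : Set V} (h0 : (0 : V) ∈ C) (hadd : ∀ a ∈ C, ∀ b ∈ C, a + b ∈ C)
    (hsmul : ∀ c : ℝ, 0 < c → ∀ a ∈ C, c • a ∈ C) {v : V} (hv : v ∉ closure C) :
    ∃ ℓ : StrongDual ℝ V, (∀ w ∈ C, ℓ w ≤ 0) ∧ 0 < ℓ v := by
  have hconv : Convex ℝ C := convex_iff_forall_pos.2 fun a ha b hb s t hs ht _ =>
    hadd _ (hsmul s hs a ha) _ (hsmul t ht b hb)
  obtain ⟨ℓ, u, hu, hvu⟩ := geometric_hahn_banach_closed_point hconv.closure isClosed_closure hv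
  have hu0 : 0 < u := by simpa using hu 0 (subset_closure h0)
  refine ⟨ℓ, fun w hw => ?_, hu0.trans hvu⟩
  by_contra! hpos
  have := hu _ (subset_closure (hsmul (u / ℓ w) (by positivity) w hw))
  rw [map_smul, smul_eq_mul, div_mul_cancel₀ _ hpos.ne'] at this
  exact lt_irrefl _ this

theorem isClosed_polarCone (C : Set E) : IsClosed (polarCone C) := by
  have : polarCone C = ⋂ z ∈ C, {v | inner ℝ v z ≤ 0} := by ext; simp [polarCone]
  rw [this]
  exact isClosed_biInter fun z _ => isClosed_le (by fun_prop) continuous_const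

theorem zero_mem_polarCone (C : Set E) : (0 : E) ∈ polarCone C := fun z _ => by simp

theorem convex_polarCone (C : Set E) : Convex ℝ (polarCone C) := by
  intro a ha b hb s t hs ht _ z hz
  rw [inner_add_left, real_inner_smul_left, real_inner_smul_left]
  nlinarith [mul_nonneg hs (neg_nonneg.2 (ha z hz)), mul_nonneg ht (neg_nonneg.2 (hb z hz))]

/-- If `q` is the projection of `g` onto `closure C`, then `g - q` lies in the polar cone and `q`
points in a direction maximizing `⟪·, g⟫`, so that both sides are equal to `‖q‖`. -/
theorem sSup_inner_cone_inter_closedBall [CompleteSpace E] {C : Set E} (h0 : (0 : E) ∈ C)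
    (hadd : ∀ a ∈ C, ∀ b ∈ C, a + b ∈ C) (hsmul : ∀ c : ℝ, 0 < c → ∀ a ∈ C, c • a ∈ C) (g : E) :
    sSup ((fun y => inner ℝ y g) '' (C ∩ Metric.closedBall 0 1)) =
      Metric.infDist g (polarCone C) := by
  have hub : ∀ y ∈ C ∩ Metric.closedBall 0 1, inner ℝ y g ≤ Metric.infDist g (polarCone C) := by
    rintro y ⟨hyC, hyB⟩
    rw [mem_closedBall_zero_iff] at hyB
    refine (Metric.le_infDist ⟨0, zero_mem_polarCone C⟩).2 fun v hv => ?_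
    have h1 : inner ℝ y v ≤ 0 := by rw [real_inner_comm]; exact hv y hyC
    have h2 := real_inner_le_norm y (g - v)
    rw [inner_sub_right] at h2
    rw [dist_eq_norm]
    nlinarith [norm_nonneg (g - v)]
  refine le_antisymm (csSup_le ⟨_, 0, ⟨h0, by simp⟩, rfl⟩ ?_) ?_
  · rintro _ ⟨y, hy, rfl⟩
    exact hub y hy
  set s := sSup ((fun y => inner ℝ y g) '' (C ∩ Metric.closedBall 0 1)) with hs
  have hle : ∀ y ∈ C ∩ Metric.closedBall 0 1, inner ℝ y g ≤ s := fun y hy =>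
    le_csSup ⟨_, by rintro _ ⟨y, hy, rfl⟩; exact hub y hy⟩ ⟨y, hy, rfl⟩
  have hhom : ∀ y ∈ closure C, inner ℝ y g ≤ s * ‖y‖ := by
    refine closure_minimal (t := {y | inner ℝ y g ≤ s * ‖y‖}) (fun y hy => ?_)
      (isClosed_le (by fun_prop) (by fun_prop))
    rcases eq_or_ne y 0 with rfl | hy0
    · simp
    have hn : 0 < ‖y‖ := norm_pos_iff.2 hy0
    have := hle (‖y‖⁻¹ • y) ⟨hsmul _ (by positivity) y hy, by
      simp [norm_smul, hn.ne']⟩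
    rw [real_inner_smul_left, inv_mul_le_iff₀ hn] at this
    simp only [Set.mem_ofPred_eq]
    linarith
  have hconv : Convex ℝ C := convex_iff_forall_pos.2 fun a ha b hb s t hs ht _ =>
    hadd _ (hsmul s hs a ha) _ (hsmul t ht b hb)
  obtain ⟨q, -, hq⟩ := exists_lipschitz_projection (K := closure C)
    ⟨0, subset_closure h0⟩ isClosed_closure hconv.closure
  obtain ⟨hqC, -, hqi⟩ := hq g
  have hadd' : ∀ y ∈ C, q g + y ∈ closure C := fun y hy =>
    map_mem_closure (f := fun p => p + y) (by fun_prop) hqC fun a ha => hadd a ha y hy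
  have hpol : g - q g ∈ polarCone C := fun y hy => by simpa using hqi _ (hadd' y hy)
  have horth : 0 ≤ inner ℝ (g - q g) (q g) := by
    have := hqi 0 (subset_closure h0)
    simpa using this
  have hinf : Metric.infDist g (polarCone C) ≤ ‖q g‖ := by
    simpa [dist_eq_norm] using Metric.infDist_le_dist_of_mem (x := g) hpol
  refine hinf.trans ?_
  have h1 := hhom _ hqC
  rw [inner_sub_left, real_inner_self_eq_norm_sq, real_inner_comm] at horth
  have hs0 : 0 ≤ s := by simpa using hle 0 ⟨h0, by simp⟩
  by_contra! hlt
  nlinarith [norm_nonneg (q g)]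

end Convex

/-! ### Subdifferential and descent cone -/

section Subdifferential

variable {E : Type*} [NormedAddCommGroup E] [InnerProductSpace ℝ E] {f : E → EReal} {x : E}
  {r : ℝ}

/-- The cone generated by the epigraph of `f` translated so that `(x, r)` becomes the origin. -/
def epiCone (f : E → EReal) (x : E) (r : ℝ) : Set (E × ℝ) :=
  {p | ∃ t : ℝ, 0 < t ∧ f (x + t • p.1) ≤ ((r + t * p.2 : ℝ) : EReal)}

theorem exists_coe_eq_of_subdifferential_nonempty (hf : IsProperConvex f)
    (hne : (subdifferential f x).Nonempty) : ∃ r : ℝ, f x = r := by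
  obtain ⟨z, hz⟩ := hne
  obtain ⟨y, hy⟩ := hf.exists_ne_top
  refine ⟨(f x).toReal, (EReal.coe_toReal (fun h => ?_) (hf.ne_bot x)).symm⟩
  have := hz y
  rw [h, EReal.top_add_coe, top_le_iff] at this
  exact hy this

theorem zero_mem_epiCone (hr : f x = r) {ρ : ℝ} (hρ : 0 ≤ ρ) : ((0 : E), ρ) ∈ epiCone f x r :=
  ⟨1, one_pos, by simp only [smul_zero, add_zero, hr]; exact_mod_cast by linarith⟩

theorem smul_mem_epiCone (c : ℝ) (hc : 0 < c) (p : E × ℝ) (hp : p ∈ epiCone f x r) :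
    c • p ∈ epiCone f x r := by
  obtain ⟨t, ht, h⟩ := hp
  refine ⟨t / c, by positivity, ?_⟩
  rw [Prod.smul_fst, Prod.smul_snd, smul_smul, smul_eq_mul, ← mul_assoc,
    div_mul_cancel₀ _ hc.ne']
  exact h

theorem add_mem_epiCone (hf : IsProperConvex f) (p : E × ℝ) (hp : p ∈ epiCone f x r) (q : E × ℝ)
    (hq : q ∈ epiCone f x r) : p + q ∈ epiCone f x r := by
  obtain ⟨t, ht, h⟩ := hp
  obtain ⟨u, hu, k⟩ := hq
  have htu : t + u ≠ 0 := by positivity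
  -- the harmonic combination of the step sizes makes the two points average to the right one
  refine ⟨t * u / (t + u), by positivity, ?_⟩
  have := hf.convex_epigraph (x := (x + t • p.1, r + t * p.2)) h (y := (x + u • q.1, r + u * q.2)) k
    (a := u / (t + u)) (b := t / (t + u)) (by positivity) (by positivity) (by field_simp; ring)
  have e : (u / (t + u)) • (x + t • p.1, r + t * p.2) + (t / (t + u)) • (x + u • q.1, r + u * q.2)
      = (x + (t * u / (t + u)) • (p + q).1, r + t * u / (t + u) * (p + q).2) := by
    ext
    · have : x = (u / (t + u) + t / (t + u)) • x := by
        rw [← add_div, add_comm u t, div_self htu, one_smul]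
      simp only [Prod.smul_mk, Prod.mk_add_mk, Prod.fst_add]
      conv_rhs => rw [this]
      module
    · simp only [Prod.smul_mk, Prod.mk_add_mk, Prod.snd_add, smul_eq_mul]
      field_simp
      ring
  rw [e] at this
  exact this

theorem mem_descentCone_iff (hr : f x = r) {d : E} :
    d ∈ descentCone f x ↔ (d, (0 : ℝ)) ∈ epiCone f x r := by
  simp [descentCone, epiCone, hr]

theorem mem_descentCone_of_epiCone (hr : f x = r) {d : E} {ρ : ℝ} (h : (d, ρ) ∈ epiCone f x r)
    (hρ : ρ ≤ 0) : d ∈ descentCone f x := by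
  obtain ⟨t, ht, h⟩ := h
  refine ⟨t, ht, h.trans ?_⟩
  rw [hr]
  exact_mod_cast by nlinarith

theorem mem_subdifferential_iff (hf : IsProperConvex f) (hr : f x = r) {z : E} :
    z ∈ subdifferential f x ↔ ∀ p ∈ epiCone f x r, inner ℝ z p.1 ≤ p.2 := by
  constructor
  · rintro hz p ⟨t, ht, h⟩
    have := (hz (x + t • p.1)).trans h
    rw [hr, add_sub_cancel_left, real_inner_smul_right] at this
    have h2 : r + t * inner ℝ z p.1 ≤ r + t * p.2 := by exact_mod_cast this
    exact le_of_mul_le_mul_left (by linarith) ht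
  · intro h y
    by_cases hy : f y = ⊤
    · rw [hy]; exact le_top
    have hs := EReal.coe_toReal hy (hf.ne_bot y)
    have := h (y - x, (f y).toReal - r) ⟨1, one_pos, by simp [hs]⟩
    rw [hr, ← hs]
    exact_mod_cast by linarith

theorem isClosed_subdifferential (hf : IsProperConvex f) (hr : f x = r) :
    IsClosed (subdifferential f x) := by
  have : subdifferential f x = ⋂ p ∈ epiCone f x r, {z | inner ℝ z p.1 ≤ p.2} := by
    ext z; simp [mem_subdifferential_iff hf hr]
  rw [this]
  exact isClosed_biInter fun z _ => isClosed_le (by fun_prop) continuous_const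

theorem convex_subdifferential (hf : IsProperConvex f) (hr : f x = r) :
    Convex ℝ (subdifferential f x) := by
  intro a ha b hb s t hs ht hst
  rw [mem_subdifferential_iff hf hr] at ha hb ⊢
  intro p hp
  rw [inner_add_left, real_inner_smul_left, real_inner_smul_left]
  calc _ ≤ s * p.2 + t * p.2 := by gcongr; exacts [ha p hp, hb p hp]
    _ = p.2 := by rw [← add_mul, hst, one_mul]

theorem existsUnique_isMinNorm [CompleteSpace E] {S : Set E} (hne : S.Nonempty)
    (hc : IsClosed S) (hS : Convex ℝ S) : ∃! z, IsMinNorm S z := by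
  obtain ⟨q, -, hq⟩ := exists_lipschitz_projection hne hc hS
  obtain ⟨h1, -, h2⟩ := hq 0
  have h3 : ∀ w ∈ S, ‖w - q 0‖ ^ 2 ≤ ‖w‖ ^ 2 - ‖q 0‖ ^ 2 := fun w hw => by
    have h4 := h2 w hw
    have h5 := norm_add_sq_real (q 0) (w - q 0)
    rw [add_sub_cancel] at h5
    rw [zero_sub, inner_neg_left] at h4
    linarith
  refine ⟨q 0, ⟨h1, fun w hw => ?_⟩, fun w hw => ?_⟩
  · exact le_of_sq_le_sq (by nlinarith [h3 w hw, sq_nonneg ‖w - q 0‖]) (norm_nonneg _)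
  · have h6 := h3 w hw.1
    have h7 := hw.2 _ h1
    have h8 : ‖w - q 0‖ ^ 2 ≤ 0 := by nlinarith [norm_nonneg w]
    exact sub_eq_zero.1 (norm_eq_zero.1 (pow_eq_zero_iff two_ne_zero |>.1
      (le_antisymm h8 (sq_nonneg _))))

/-- The cone `⋃_{t ≥ 0} t S` generated by a set. -/
def rayCone (S : Set E) : Set E := {p | ∃ t : ℝ, 0 ≤ t ∧ ∃ s ∈ S, p = t • s}

theorem rayCone_smul {S : Set E} (c : ℝ) (hc : 0 < c) (p : E) (hp : p ∈ rayCone S) :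
    c • p ∈ rayCone S := by
  obtain ⟨t, ht, s, hs, rfl⟩ := hp
  exact ⟨c * t, by positivity, s, hs, by rw [smul_smul]⟩

theorem rayCone_add {S : Set E} (hS : Convex ℝ S) (p : E) (hp : p ∈ rayCone S) (q : E)
    (hq : q ∈ rayCone S) : p + q ∈ rayCone S := by
  obtain ⟨t, ht, a, ha, rfl⟩ := hp
  obtain ⟨u, hu, b, hb, rfl⟩ := hq
  rcases (add_nonneg ht hu).eq_or_lt' with h | h
  · have ht0 : t = 0 := by linarith
    have hu0 : u = 0 := by linarith
    exact ⟨0, le_rfl, a, ha, by simp [ht0, hu0]⟩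
  · refine ⟨t + u, h.le, _, hS ha hb (a := t / (t + u)) (b := u / (t + u)) (by positivity)
      (by positivity) (by field_simp), ?_⟩
    rw [smul_add, smul_smul, smul_smul, mul_div_cancel₀ _ h.ne', mul_div_cancel₀ _ h.ne']

theorem smul_subdifferential_subset_polarCone (hf : IsProperConvex f) (hr : f x = r) {t : ℝ}
    (ht : 0 ≤ t) : t • subdifferential f x ⊆ polarCone (descentCone f x) := by
  rintro _ ⟨z, hz, rfl⟩ d hd
  have := (mem_subdifferential_iff hf hr).1 hz _ ((mem_descentCone_iff hr).1 hd)
  simp only at this ⊢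
  rw [real_inner_smul_left]
  exact mul_nonpos_of_nonneg_of_nonpos ht this

/-- If `⟪z, d⟫ ≤ -η` for all subgradients `z`, then `(d, -η)` is a limit of points of the epigraph
cone: the support function of the subdifferential is the closure of the directional derivative. -/
theorem mem_closure_epiCone [CompleteSpace E] (hf : IsProperConvex f) (hr : f x = r)
    (hne : (subdifferential f x).Nonempty) {d : E} {η : ℝ}
    (h : ∀ z ∈ subdifferential f x, inner ℝ z d ≤ -η) :
    (d, -η) ∈ closure (epiCone f x r) := by
  by_contra hnot
  obtain ⟨ℓ, hℓ, hpos⟩ := exists_strongDual_of_notMem_closure_cone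
    (zero_mem_epiCone hr le_rfl) (add_mem_epiCone hf) smul_mem_epiCone hnot
  obtain ⟨s, hs⟩ : ∃ s : ℝ, s = ℓ (0, 1) := ⟨_, rfl⟩
  obtain ⟨z, hz⟩ : ∃ z : E, ∀ y, inner ℝ z y = ℓ (y, 0) :=
    ⟨(InnerProductSpace.toDual ℝ E).symm (ℓ.comp (ContinuousLinearMap.inl ℝ E ℝ)), fun y => by
      simp⟩
  have hdec : ∀ p : E × ℝ, ℓ p = inner ℝ z p.1 + s * p.2 := fun p => by
    have e : p = (p.1, 0) + p.2 • ((0 : E), (1 : ℝ)) := by ext <;> simp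
    rw [hz, hs]
    conv_lhs => rw [e, map_add, map_smul, smul_eq_mul]
    ring
  rw [hdec] at hpos
  simp only at hpos
  have hs0 : s ≤ 0 := hs ▸ hℓ _ (zero_mem_epiCone hr zero_le_one)
  rcases hs0.lt_or_eq with hs1 | hs1
  · -- the functional is a multiple of one given by a subgradient
    have hmem : (-s)⁻¹ • z ∈ subdifferential f x :=
      (mem_subdifferential_iff hf hr).2 fun p hp => by
        have := hℓ p hp
        rw [hdec] at this
        rw [real_inner_smul_left, inv_mul_le_iff₀ (by linarith)]
        linarith
    have := h _ hmem
    rw [real_inner_smul_left, inv_mul_le_iff₀ (by linarith)] at this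
    linarith
  · -- the functional gives a direction in which the subdifferential recedes
    obtain ⟨z₁, hz₁⟩ := hne
    rw [hs1, zero_mul, add_zero] at hpos
    have hrec : ∀ M : ℝ, 0 ≤ M → z₁ + M • z ∈ subdifferential f x := fun M hM =>
      (mem_subdifferential_iff hf hr).2 fun p hp => by
        have h1 := hℓ p hp
        rw [hdec, hs1] at h1
        have h2 := (mem_subdifferential_iff hf hr).1 hz₁ p hp
        rw [inner_add_left, real_inner_smul_left]
        nlinarith
    have h1 := h z₁ hz₁
    have h2 := h _ (hrec ((-η - inner ℝ z₁ d + 1) / inner ℝ z d) (div_nonneg (by linarith) hpos.le))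
    rw [inner_add_left, real_inner_smul_left, div_mul_cancel₀ _ hpos.ne'] at h2
    linarith

/-- When the subdifferential lies in a hyperplane that avoids the origin, the polar of the
descent cone is the closure of the cone generated by the subdifferential. -/
theorem polarCone_descentCone_subset [CompleteSpace E] (hf : IsProperConvex f) (hr : f x = r)
    (hne : (subdifferential f x).Nonempty) {z₀ : E} (hz₀ : z₀ ≠ 0)
    (hcond : ∀ z ∈ subdifferential f x, inner ℝ (z - z₀) z₀ = 0) :
    polarCone (descentCone f x) ⊆ closure (rayCone (subdifferential f x)) := by
  intro v hv
  by_contra hnot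
  obtain ⟨ℓ, hℓ, hpos⟩ := exists_strongDual_of_notMem_closure_cone
    (C := rayCone (subdifferential f x)) ⟨0, le_rfl, hne.some, hne.some_mem, by simp⟩
    (rayCone_add (convex_subdifferential hf hr)) rayCone_smul hnot
  obtain ⟨d, hd⟩ : ∃ d : E, ∀ y, inner ℝ d y = ℓ y :=
    ⟨(InnerProductSpace.toDual ℝ E).symm ℓ, fun y => by simp⟩
  -- tilting `d` along `-z₀` makes it strictly negative on the subdifferential
  obtain ⟨ε, hε, hεv⟩ : ∃ ε : ℝ, 0 < ε ∧ 0 < inner ℝ v (d - ε • z₀) := by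
    refine ⟨ℓ v / (2 * (|inner ℝ v z₀| + 1)), by positivity, ?_⟩
    rw [inner_sub_right, real_inner_smul_right, real_inner_comm, hd, div_mul_eq_mul_div, sub_pos,
      div_lt_iff₀ (by positivity)]
    nlinarith [le_abs_self (inner ℝ v z₀), abs_nonneg (inner ℝ v z₀)]
  have hz0 : 0 < ‖z₀‖ := norm_pos_iff.2 hz₀
  have hη : 0 < ε * ‖z₀‖ ^ 2 := by positivity
  have hmem := mem_closure_epiCone hf hr hne (d := d - ε • z₀) (η := ε * ‖z₀‖ ^ 2)
    fun z hz => by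
      have h1 := hℓ z ⟨1, zero_le_one, z, hz, by simp⟩
      have h2 := hcond z hz
      rw [inner_sub_left, real_inner_self_eq_norm_sq] at h2
      rw [inner_sub_right, real_inner_smul_right, real_inner_comm, hd]
      nlinarith
  obtain ⟨⟨d', ρ⟩, ⟨h1, h2⟩, h3⟩ := mem_closure_iff.1 hmem
    ({p : E × ℝ | 0 < inner ℝ v p.1} ∩ {p | p.2 < 0})
    ((isOpen_lt continuous_const (by fun_prop)).inter
      (isOpen_lt continuous_snd continuous_const)) ⟨hεv, by simpa using hη⟩
  exact absurd (hv d' (mem_descentCone_of_epiCone hr h3 h2.le)) (not_le.2 h1)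

/-- A point `p` of the cone over `S` at height `τ = ⟪p, z₀⟫ / ‖z₀‖²` is moved into `T S`, for
`T > τ`, by adding `(T - τ) z₁`. -/
theorem infDist_smul_le {S : Set E} (hS : Convex ℝ S) {z₀ z₁ p : E} (hz₀ : z₀ ≠ 0)
    (hcond : ∀ z ∈ S, inner ℝ (z - z₀) z₀ = 0) (hz₁ : z₁ ∈ S) (hp : p ∈ closure (rayCone S))
    {T : ℝ} (hT : inner ℝ p z₀ / ‖z₀‖ ^ 2 < T) :
    Metric.infDist p (T • S) ≤ (T - inner ℝ p z₀ / ‖z₀‖ ^ 2) * ‖z₁‖ := by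
  have hz0 : 0 < ‖z₀‖ := norm_pos_iff.2 hz₀
  have hO : IsOpen {q : E | inner ℝ q z₀ / ‖z₀‖ ^ 2 < T} :=
    isOpen_lt (by fun_prop) continuous_const
  have hclos : p ∈ closure ({q : E | inner ℝ q z₀ / ‖z₀‖ ^ 2 < T} ∩ rayCone S) :=
    hO.inter_closure ⟨hT, hp⟩
  refine closure_minimal (t := {q | Metric.infDist q (T • S) ≤
    (T - inner ℝ q z₀ / ‖z₀‖ ^ 2) * ‖z₁‖}) ?_ (isClosed_le (Metric.continuous_infDist_pt _)
    (by fun_prop)) hclos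
  rintro _ ⟨hq, t, ht, s, hs, rfl⟩
  have hτ : inner ℝ (t • s) z₀ / ‖z₀‖ ^ 2 = t := by
    have h2 := hcond s hs
    rw [inner_sub_left, real_inner_self_eq_norm_sq] at h2
    rw [real_inner_smul_left, sub_eq_zero.1 h2]
    field_simp
  simp only [Set.mem_ofPred_eq, hτ] at hq ⊢
  have hT0 : 0 < T := ht.trans_lt hq
  have hmem : t • s + (T - t) • z₁ ∈ T • S := by
    refine ⟨(t / T) • s + ((T - t) / T) • z₁, hS hs hz₁ (by positivity)
      (div_nonneg (by linarith) hT0.le) (by field_simp; ring), ?_⟩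
    simp only
    rw [smul_add, smul_smul, smul_smul, mul_div_cancel₀ _ hT0.ne', mul_div_cancel₀ _ hT0.ne']
  refine (Metric.infDist_le_dist_of_mem hmem).trans (le_of_eq ?_)
  rw [dist_eq_norm, sub_add_cancel_left, norm_neg, norm_smul, Real.norm_of_nonneg (by linarith)]

end Subdifferential

/-! ### Comparison of means of concentrated random variables -/

/-- If `φ ≤ ψ + κ` whenever `u` is within `lam` of its mean, then the means of `φ` and `ψ` obey the
same inequality up to an error that depends on the variances only. -/
theorem integral_le_integral_add_of_variance_le {Ω : Type*} [MeasurableSpace Ω] {μ : Measure Ω}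
    [IsProbabilityMeasure μ] {φ ψ u : Ω → ℝ} (hφ : MemLp φ 2 μ) (hψ : MemLp ψ 2 μ)
    (hu : MemLp u 2 μ) {V lam κ c : ℝ} (hV : 0 < V) (hVφ : Var[φ; μ] ≤ V) (hVψ : Var[ψ; μ] ≤ V)
    (hVu : Var[u; μ] ≤ V) (hlam0 : 0 ≤ lam) (hlam : V < lam ^ 2) (hc : 0 ≤ c)
    (hcV : 4 * V ^ 2 ≤ c ^ 2 * (lam ^ 2 - V))
    (hle : ∀ ω, |u ω - ∫ ω', u ω' ∂μ| < lam → φ ω ≤ ψ ω + κ) :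
    ∫ ω, φ ω ∂μ ≤ ∫ ω, ψ ω ∂μ + κ + c := by
  rw [variance_eq_integral hφ.aemeasurable] at hVφ
  rw [variance_eq_integral hψ.aemeasurable] at hVψ
  rw [variance_eq_integral hu.aemeasurable] at hVu
  set A := ∫ ω, φ ω ∂μ with hA
  set B := ∫ ω, ψ ω ∂μ with hB
  set U := ∫ ω, u ω ∂μ with hU
  by_contra! hlt
  obtain ⟨m, hm⟩ : ∃ m, m = A - B - κ := ⟨_, rfl⟩
  have hmc : c < m := by linarith
  have hm0 : 0 < m := hc.trans_lt hmc
  -- the shift `a` makes the Cantelli bound on the lower tail of `φ - ψ` optimal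
  obtain ⟨a, ha⟩ : ∃ a, a = 4 * V / m := ⟨_, rfl⟩
  have ha0 : 0 < a := ha ▸ by positivity
  have hφ0 : MemLp (fun ω => φ ω - A) 2 μ := hφ.sub (memLp_const A)
  have hψ0 : MemLp (fun ω => ψ ω - B) 2 μ := hψ.sub (memLp_const B)
  have hu0 : MemLp (fun ω => u ω - U) 2 μ := hu.sub (memLp_const U)
  have hlam2 : 0 < lam ^ 2 := hV.trans hlam
  -- Chebyshev for `u` and Cantelli for `φ - ψ`, added pointwise: one of the two events occurs
  have hpt : ∀ ω, 1 ≤ (u ω - U) ^ 2 / lam ^ 2 +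
      ((2 * (φ ω - A) ^ 2 + 2 * (ψ ω - B) ^ 2 + a ^ 2) -
        2 * a * ((φ ω - A) - (ψ ω - B))) / (m + a) ^ 2 := by
    intro ω
    have hnn : 0 ≤ (u ω - U) ^ 2 / lam ^ 2 := by positivity
    have hsq : ((φ ω - A) - (ψ ω - B) - a) ^ 2 ≤
        (2 * (φ ω - A) ^ 2 + 2 * (ψ ω - B) ^ 2 + a ^ 2) - 2 * a * ((φ ω - A) - (ψ ω - B)) := by
      nlinarith [sq_nonneg ((φ ω - A) + (ψ ω - B))]
    by_cases hω : |u ω - U| < lam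
    · have h1 := hle ω hω
      have h2 : 1 ≤ ((2 * (φ ω - A) ^ 2 + 2 * (ψ ω - B) ^ 2 + a ^ 2) -
          2 * a * ((φ ω - A) - (ψ ω - B))) / (m + a) ^ 2 := by
        rw [one_le_div (by positivity)]
        refine le_trans ?_ hsq
        have : m + a ≤ -((φ ω - A) - (ψ ω - B) - a) := by linarith
        nlinarith
      linarith
    · have h1 : 1 ≤ (u ω - U) ^ 2 / lam ^ 2 := by
        rw [one_le_div hlam2]
        rw [← sq_abs (u ω - U)]
        exact pow_le_pow_left₀ hlam0 (not_lt.1 hω) 2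
      have h2 : 0 ≤ ((2 * (φ ω - A) ^ 2 + 2 * (ψ ω - B) ^ 2 + a ^ 2) -
          2 * a * ((φ ω - A) - (ψ ω - B))) / (m + a) ^ 2 :=
        div_nonneg ((sq_nonneg _).trans hsq) (sq_nonneg _)
      linarith
  have hiφ := hφ0.integrable one_le_two
  have hiψ := hψ0.integrable one_le_two
  have i1 : Integrable (fun ω => (u ω - U) ^ 2 / lam ^ 2) μ := hu0.integrable_sq.div_const _
  have i2 : Integrable (fun ω => 2 * (φ ω - A) ^ 2) μ := hφ0.integrable_sq.const_mul 2
  have i3 : Integrable (fun ω => 2 * (ψ ω - B) ^ 2) μ := hψ0.integrable_sq.const_mul 2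
  have i23 : Integrable (fun ω => 2 * (φ ω - A) ^ 2 + 2 * (ψ ω - B) ^ 2) μ := i2.add i3
  have i4 : Integrable (fun ω => 2 * (φ ω - A) ^ 2 + 2 * (ψ ω - B) ^ 2 + a ^ 2) μ :=
    i23.add (integrable_const _)
  have i5 : Integrable (fun ω => 2 * a * ((φ ω - A) - (ψ ω - B))) μ :=
    (hiφ.sub hiψ).const_mul _
  have i6 : Integrable (fun ω => ((2 * (φ ω - A) ^ 2 + 2 * (ψ ω - B) ^ 2 + a ^ 2) -
      2 * a * ((φ ω - A) - (ψ ω - B))) / (m + a) ^ 2) μ := (i4.sub i5).div_const _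
  have hcφ : ∫ ω, (φ ω - A) ∂μ = 0 := by
    rw [integral_sub (hφ.integrable one_le_two) (integrable_const _)]; simp [hA]
  have hcψ : ∫ ω, (ψ ω - B) ∂μ = 0 := by
    rw [integral_sub (hψ.integrable one_le_two) (integrable_const _)]; simp [hB]
  have hint := integral_mono (integrable_const 1) (i1.add i6) hpt
  have hsum : ∫ ω, ((u ω - U) ^ 2 / lam ^ 2 +
      ((2 * (φ ω - A) ^ 2 + 2 * (ψ ω - B) ^ 2 + a ^ 2) -
        2 * a * ((φ ω - A) - (ψ ω - B))) / (m + a) ^ 2) ∂μ =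
      (∫ ω, (u ω - U) ^ 2 ∂μ) / lam ^ 2 +
        (2 * (∫ ω, (φ ω - A) ^ 2 ∂μ) + 2 * (∫ ω, (ψ ω - B) ^ 2 ∂μ) + a ^ 2) / (m + a) ^ 2 := by
    rw [integral_add i1 i6, integral_div, integral_div,
      integral_sub i4 i5, integral_add i23 (integrable_const _), integral_add i2 i3,
      integral_const_mul, integral_const_mul, integral_const_mul, integral_sub hiφ hiψ, hcφ, hcψ]
    simp
  have hone : ∫ _, (1 : ℝ) ∂μ = 1 := by simp
  have h1 : 1 ≤ V / lam ^ 2 + (2 * V + 2 * V + a ^ 2) / (m + a) ^ 2 := by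
    rw [← hone]
    refine hint.trans (hsum.le.trans ?_)
    gcongr
  have h2 : (2 * V + 2 * V + a ^ 2) / (m + a) ^ 2 = 4 * V / (m ^ 2 + 4 * V) := by
    rw [ha]; field_simp; ring
  have h3 : 4 * V / (m ^ 2 + 4 * V) = 1 - m ^ 2 / (m ^ 2 + 4 * V) := by field_simp; ring
  rw [h2, h3] at h1
  have h4 : m ^ 2 / (m ^ 2 + 4 * V) ≤ V / lam ^ 2 := by linarith
  rw [div_le_div_iff₀ (by positivity) hlam2] at h4
  have h5 : c ^ 2 < m ^ 2 := by gcongr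
  nlinarith

/-! ### Distance to dilates of the subdifferential and to the polar cone -/

section Main

variable {n : ℕ}

theorem variance_stdGaussian_le_of_lipschitz_one {F : EuclideanSpace ℝ (Fin n) → ℝ}
    (hF : LipschitzWith 1 F) : Var[F; stdGaussian (EuclideanSpace ℝ (Fin n))] ≤ 5 / 4 := by
  refine hF.variance_stdGaussian_le.trans ?_
  have := Real.pi_lt_d2
  have := Real.pi_pos
  rw [NNReal.coe_one]
  nlinarith

/-- The dilation factor is the mean height of the projection of `g` onto the cone `K`, plus
`lam` in units of `1 / ‖z₀‖`, so that the projection lies below it with large probability. -/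
theorem exists_integral_infDist_smul_le {S K : Set (EuclideanSpace ℝ (Fin n))} (hS : Convex ℝ S)
    (hKc : IsClosed K) (hK : Convex ℝ K) (hK0 : 0 ∈ K) (hKS : K ⊆ closure (rayCone S))
    {z₀ z₁ : EuclideanSpace ℝ (Fin n)} (hz₀ : z₀ ≠ 0) (hcond : ∀ z ∈ S, inner ℝ (z - z₀) z₀ = 0)
    (hz₁ : z₁ ∈ S) {lam c : ℝ} (hlam0 : 0 < lam) (hlam : 5 / 4 < lam ^ 2) (hc : 0 ≤ c)
    (hc2 : 4 * (5 / 4) ^ 2 ≤ c ^ 2 * (lam ^ 2 - 5 / 4)) :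
    ∃ T : ℝ, 0 ≤ T ∧
      ∫ g, Metric.infDist g (T • S) ∂(stdGaussian (EuclideanSpace ℝ (Fin n))) ≤
        ∫ g, Metric.infDist g K ∂(stdGaussian (EuclideanSpace ℝ (Fin n))) +
          2 * lam * (‖z₁‖ / ‖z₀‖) + c := by
  have hz0 : 0 < ‖z₀‖ := norm_pos_iff.2 hz₀
  obtain ⟨q, hqL, hq⟩ := exists_lipschitz_projection ⟨0, hK0⟩ hKc hK
  have huL : LipschitzWith 1 fun g => inner ℝ (q g) z₀ / ‖z₀‖ := by
    refine LipschitzWith.of_dist_le_mul fun g h => ?_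
    have h1 := hqL.dist_le_mul g h
    rw [NNReal.coe_one, one_mul] at h1 ⊢
    refine le_trans ?_ h1
    rw [Real.dist_eq, ← sub_div, ← inner_sub_left, abs_div, abs_norm, div_le_iff₀ hz0,
      dist_eq_norm]
    exact abs_real_inner_le_norm _ _
  have hu0 : ∀ p ∈ closure (rayCone S), 0 ≤ inner ℝ p z₀ := by
    refine closure_minimal (t := {p | 0 ≤ inner ℝ p z₀}) ?_
      (isClosed_le continuous_const (by fun_prop))
    rintro _ ⟨t, ht, s, hs, rfl⟩
    have h2 := hcond s hs
    rw [inner_sub_left, sub_eq_zero, real_inner_self_eq_norm_sq] at h2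
    rw [Set.mem_ofPred_eq, real_inner_smul_left, h2]
    positivity
  set U := ∫ g, inner ℝ (q g) z₀ / ‖z₀‖ ∂(stdGaussian (EuclideanSpace ℝ (Fin n))) with hU
  have hU0 : 0 ≤ U := integral_nonneg fun g => div_nonneg (hu0 _ (hKS (hq g).1)) hz0.le
  refine ⟨(U + lam) / ‖z₀‖, by positivity, ?_⟩
  have hφL := Metric.lipschitz_infDist_pt (((U + lam) / ‖z₀‖) • S)
  have hψL := Metric.lipschitz_infDist_pt K
  refine integral_le_integral_add_of_variance_le hφL.memLp_stdGaussian hψL.memLp_stdGaussian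
    huL.memLp_stdGaussian (by norm_num) (variance_stdGaussian_le_of_lipschitz_one hφL)
    (variance_stdGaussian_le_of_lipschitz_one hψL) (variance_stdGaussian_le_of_lipschitz_one huL)
    hlam0.le hlam hc hc2 fun g hg => ?_
  rw [← hU, abs_lt] at hg
  have hτ : inner ℝ (q g) z₀ / ‖z₀‖ ^ 2 = inner ℝ (q g) z₀ / ‖z₀‖ / ‖z₀‖ := by
    rw [div_div, sq]
  have h1 := infDist_smul_le hS hz₀ hcond hz₁ (hKS (hq g).1) (T := (U + lam) / ‖z₀‖) (by
    rw [hτ]; gcongr; linarith)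
  have h2 := Metric.infDist_le_infDist_add_dist (s := ((U + lam) / ‖z₀‖) • S) (x := g) (y := q g)
  have h3 : ((U + lam) / ‖z₀‖ - inner ℝ (q g) z₀ / ‖z₀‖ ^ 2) * ‖z₁‖ ≤
      2 * lam * (‖z₁‖ / ‖z₀‖) := by
    rw [hτ, ← sub_div, div_mul_eq_mul_div, mul_div_assoc]
    gcongr
    linarith
  rw [dist_eq_norm, ← (hq g).2.1] at h2
  linarith

theorem gaussianWidth_descentCone {f : EuclideanSpace ℝ (Fin n) → EReal}
    {x : EuclideanSpace ℝ (Fin n)} {r : ℝ} (hf : IsProperConvex f) (hr : f x = r) :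
    gaussianWidth (descentCone f x ∩ Metric.closedBall 0 1) =
      ∫ g, Metric.infDist g (polarCone (descentCone f x)) ∂(stdGaussian _) := by
  unfold gaussianWidth
  congr 1 with g
  refine sSup_inner_cone_inter_closedBall ((mem_descentCone_iff hr).2 (zero_mem_epiCone hr le_rfl))
    (fun a ha b hb => ?_) (fun c hc a ha => ?_) g
  · rw [mem_descentCone_iff hr] at ha hb ⊢
    simpa using add_mem_epiCone hf _ ha _ hb
  · rw [mem_descentCone_iff hr] at ha ⊢
    simpa using smul_mem_epiCone c hc _ ha

/-- Each exponential term alone is less than `1`, so `lam ^ 2 > 4 log 2` and `ζ ^ 2 > 2 log 2`. -/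
theorem lt_sq_of_exp_sum_lt_one {lam ζ : ℝ}
    (h : 0 < 1 - 4 * Real.exp (-lam ^ 2 / 2) - 2 * Real.exp (-ζ ^ 2 / 2)) :
    2.76 < lam ^ 2 ∧ 1 < ζ ^ 2 := by
  have h1 := Real.exp_pos (-lam ^ 2 / 2)
  have h2 := Real.exp_pos (-ζ ^ 2 / 2)
  have h3 := Real.log_two_gt_d9
  have e1 : -lam ^ 2 / 2 < Real.log (1 / 4) :=
    (Real.lt_log_iff_exp_lt (by norm_num)).2 (by linarith)
  have e2 : -ζ ^ 2 / 2 < Real.log (1 / 2) :=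
    (Real.lt_log_iff_exp_lt (by norm_num)).2 (by linarith)
  rw [show (1 / 4 : ℝ) = (2 ^ 2)⁻¹ by norm_num, Real.log_inv, Real.log_pow] at e1
  rw [one_div, Real.log_inv] at e2
  push_cast at e1
  constructor <;> linarith

theorem le_gammaConst {lam ζ : ℝ}
    (h : 0 < 1 - 4 * Real.exp (-lam ^ 2 / 2) - 2 * Real.exp (-ζ ^ 2 / 2)) :
    8.4 ≤ gammaConst lam ζ := by
  have h1 := Real.exp_pos (-lam ^ 2 / 2)
  have h2 := Real.exp_pos (-ζ ^ 2 / 2)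
  have hlog : 1 ≤ Real.log (3 / (1 - 4 * Real.exp (-lam ^ 2 / 2) - 2 * Real.exp (-ζ ^ 2 / 2))) := by
    rw [Real.le_log_iff_exp_le (by positivity), le_div_iff₀ h]
    nlinarith [Real.exp_one_lt_d9, Real.exp_pos 1]
  have h72 : (8.4 : ℝ) ≤ Real.sqrt 72 := Real.le_sqrt_of_sq_le (by norm_num)
  have h3 : 1 ≤ Real.sqrt (Real.log
      (3 / (1 - 4 * Real.exp (-lam ^ 2 / 2) - 2 * Real.exp (-ζ ^ 2 / 2)))) :=
    Real.one_le_sqrt.2 hlog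
  unfold gammaConst
  nlinarith

theorem integral_sq_infDist (S : Set (EuclideanSpace ℝ (Fin n))) :
    ∫ g, Metric.infDist g S ^ 2 ∂(stdGaussian _) =
      Var[(Metric.infDist · S); stdGaussian _] + (∫ g, Metric.infDist g S ∂(stdGaussian _)) ^ 2 := by
  rw [variance_eq_sub (Metric.lipschitz_infDist_pt S).memLp_stdGaussian]
  simp

end Main

/-! ### The error bounds -/

theorem mainTheorem1 (n : ℕ) (f : EuclideanSpace ℝ (Fin n) → EReal) (hf : IsProperConvex f)
    (x : EuclideanSpace ℝ (Fin n)) (hx : x ≠ 0)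
    (hne : (subdifferential f x).Nonempty)
    (z₀ : EuclideanSpace ℝ (Fin n)) (hz₀ : z₀ ≠ 0)
    (hcond : ∀ z ∈ subdifferential f x, inner ℝ (z - z₀) z₀ = 0) :
    (∃! z₁, IsMinNorm (subdifferential f x) z₁) ∧
    ∀ z₁, IsMinNorm (subdifferential f x) z₁ → ∀ β : ℝ, β = ‖z₁‖ / ‖z₀‖ →
      (∀ lam ζ : ℝ, 0 < lam → 0 < ζ →
        0 < 1 - 4 * Real.exp (-lam ^ 2 / 2) - 2 * Real.exp (-ζ ^ 2 / 2) →
        0 ≤ errorGap f x ∧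
        errorGap f x ≤
          (4 * lam * β + gammaConst lam ζ) *
              gaussianWidth (descentCone f x ∩ Metric.closedBall 0 1)
            + gammaConst lam ζ * (ζ + 2 * lam * β) + 4 * lam ^ 2 * β ^ 2) ∧
      0 ≤ infExpDist (subdifferential f x)
            - gaussianWidth (descentCone f x ∩ Metric.closedBall 0 1) ∧
      infExpDist (subdifferential f x)
            - gaussianWidth (descentCone f x ∩ Metric.closedBall 0 1) ≤ 1.6 + 4 * β := by
  obtain ⟨r, hr⟩ := exists_coe_eq_of_subdifferential_nonempty hf hne
  have hSconv := convex_subdifferential hf hr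
  refine ⟨existsUnique_isMinNorm hne (isClosed_subdifferential hf hr) hSconv, ?_⟩
  rintro z₁ ⟨hz₁, -⟩ β rfl
  have hβ : 0 ≤ ‖z₁‖ / ‖z₀‖ := by positivity
  rw [gaussianWidth_descentCone hf hr]
  unfold errorGap statDim infExpSqDist infExpDist
  set S := subdifferential f x
  set K := polarCone (descentCone f x)
  set β := ‖z₁‖ / ‖z₀‖
  set γ := stdGaussian (EuclideanSpace ℝ (Fin n))
  have hex := fun lam c => exists_integral_infDist_smul_le (lam := lam) (c := c) hSconv
    (isClosed_polarCone (descentCone f x)) (convex_polarCone _) (zero_mem_polarCone _)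
    (polarCone_descentCone_subset hf hr hne hz₀ hcond) hz₀ hcond hz₁
  have hmem : ∀ A : Set (EuclideanSpace ℝ (Fin n)), MemLp (Metric.infDist · A) 2 γ := fun A =>
    (Metric.lipschitz_infDist_pt A).memLp_stdGaussian
  have hmono : ∀ t : ℝ, 0 ≤ t → ∀ g, Metric.infDist g K ≤ Metric.infDist g (t • S) := fun t ht g =>
    Metric.infDist_le_infDist_of_subset (smul_subdifferential_subset_polarCone hf hr ht)
      hne.smul_set
  have hω : 0 ≤ ∫ g, Metric.infDist g K ∂γ := integral_nonneg fun g => Metric.infDist_nonneg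
  have hbdd : BddBelow ((fun t : ℝ => ∫ g, Metric.infDist g (t • S) ∂γ) '' Set.Ici 0) :=
    ⟨0, by rintro _ ⟨t, -, rfl⟩; exact integral_nonneg fun g => Metric.infDist_nonneg⟩
  have hbdd2 : BddBelow ((fun t : ℝ => ∫ g, Metric.infDist g (t • S) ^ 2 ∂γ) '' Set.Ici 0) :=
    ⟨0, by rintro _ ⟨t, -, rfl⟩; exact integral_nonneg fun g => sq_nonneg _⟩
  refine ⟨fun lam ζ hlam hζ hP => ⟨?_, ?_⟩, ?_, ?_⟩
  · rw [sub_nonneg]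
    refine le_csInf (Set.nonempty_Ici.image _) ?_
    rintro _ ⟨t, ht, rfl⟩
    refine integral_mono (hmem K).integrable_sq (hmem _).integrable_sq fun g => ?_
    exact pow_le_pow_left₀ Metric.infDist_nonneg (hmono t ht g) 2
  · -- `c = 2.1` satisfies the variance condition for every admissible `lam`, and
    -- `2 * c ≤ gammaConst lam ζ`, `c ^ 2 + 5 / 4 ≤ gammaConst lam ζ * ζ`
    obtain ⟨hl, hz⟩ := lt_sq_of_exp_sum_lt_one hP
    have hγ := le_gammaConst hP
    have hζ1 : 1 < ζ := by nlinarith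
    obtain ⟨T, hT, hle⟩ := hex lam 2.1 hlam (by linarith) (by norm_num) (by nlinarith)
    have hinf := csInf_le hbdd2 ⟨T, hT, rfl⟩
    have hV := variance_stdGaussian_le_of_lipschitz_one (Metric.lipschitz_infDist_pt (T • S))
    have hV0 := variance_nonneg (Metric.infDist · K) γ
    have hφ : 0 ≤ ∫ g, Metric.infDist g (T • S) ∂γ := integral_nonneg fun g => Metric.infDist_nonneg
    simp only at hinf
    -- second moments are squared means up to a variance between `0` and `5 / 4`
    rw [integral_sq_infDist] at hinf ⊢
    generalize ∫ g, Metric.infDist g K ∂γ = w at *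
    generalize gammaConst lam ζ = G at *
    have hsq := pow_le_pow_left₀ hφ hle 2
    have hlb : 0 ≤ lam * β := by positivity
    have k1 : 0 ≤ (G - 4.2) * w := mul_nonneg (by linarith) hω
    have k2 : 0 ≤ (G - 4.2) * (lam * β) := mul_nonneg (by linarith) hlb
    have k3 : 0 ≤ (G - 8.4) * (ζ - 1) := mul_nonneg (by linarith) (by linarith)
    nlinarith
  · rw [sub_nonneg]
    refine le_csInf (Set.nonempty_Ici.image _) ?_
    rintro _ ⟨t, ht, rfl⟩
    exact integral_mono ((hmem K).integrable one_le_two) ((hmem _).integrable one_le_two)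
      (hmono t ht)
  · obtain ⟨T, hT, hle⟩ := hex 2 1.6 (by norm_num) (by norm_num) (by norm_num) (by norm_num)
    have hinf := csInf_le hbdd ⟨T, hT, rfl⟩
    simp only at hinf
    linarith
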